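/- Notation. Let $\mathcal P^m=\{I,X,Y,Z\}^m$ be the $m$-qubit Pauli operators modulo phase, let $\langle P,Q\rangle\in\{0,1\}$ be $0$ if $P,Q$ commute and $1$ otherwise, and let the weight pattern of a Pauli operator be the bit string recording the qubits on which it acts nontrivially. Let $S_1,\dots,S_n\in\mathcal P^m$ be pairwise commuting (stabilizers; not necessarily independent), $S^k=\prod_i S_i^{k_i}$ (modulo phase) for $k\in\mathbb Z_2^n$, and let $G$ be the syndrome-extraction circuit on $m$ system qubits and $n$ ancillas: for $i=1,\dots,n$ in turn, a Hadamard gate on ancilla $i$, controlled-$S_i$ with ancilla $i$ as control, and a Hadamard gate on ancilla $i$. Noise models. Fix also an arbitrary family of Clifford gates $(G_\gamma)_{\gamma}$ on the $n+m$ qubits. A noise model $\mathcal N$ consists of: an initial state $\rho$ such that for every weight pattern $v\in\mathbb Z_2^{n+m}$ there is a Pauli operator $R$ of pattern $v$ with $\mathrm{Tr}(R\rho)\ne0$; for each $\gamma$ a Pauli channel $\Lambda_\gamma$; a probability distribution $p_{a,b}^P$ ($a,b\in\mathbb Z_2^n$, $P\in\mathcal P^m$), the Pauli error rates of the mid-circuit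 measurement (MCM); and a Pauli channel $\Lambda_M$ whose Pauli fidelities depend only on the weight pattern. All error rates are strictly positive, and so are all Pauli fidelities: those of $\Lambda_\gamma$ and $\Lambda_M$ (the numbers $\sum_P(-1)^{\langle P,Q\rangle}p^P$), and those of the MCM, $$\lambda_{x,y}^Q=\sum_{a,b,P}(-1)^{a\cdot x+b\cdot y+\langle P,Q\rangle}p_{a,b}^P .$$ The noisy MCM with readout $k$ acts by $\sigma\mapsto\sum_{a,b,P}p_{a,b}^P\,(P\otimes|k+b\rangle\langle k+a|)\,G\sigma G^\dagger\,(P\otimes|k+a\rangle\langle k+b|)$. An experiment prepares $\rho$, applies a finite sequence of steps, each a noiseless layer of arbitrary single-qubit unitaries, a gate $G_\gamma$ followed by $\Lambda_\gamma$, or the noisy MCM, and ends with a measurement of an arbitrary POVM preceded by $\Lambda_M$. Two noise models are indistinguishable if every experiment has the same joint distribution of all readouts and outcomes under both. A real function $f$ of noise models is learnable if $f(\mathcal N_1)=f(\mathcal N_2)$ whenever $\mathcal N_1,\mathcal N_2$ are indistinguishable. The first-order approximation of $p_{a,b}^P$ is $$\hat p_{a,b}^P=\frac1{4^{n+m}}\sum_{x,y\in\mathbb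 Z_2^n,\,Q\in\mathcal P^m}(-1)^{a\cdot x+b\cdot y+\langle P,Q\rangle}\bigl(1+\log\lambda_{x,y}^Q\bigr).$$ Proposition. For every $P\in\mathcal P^m$ that commutes with all of $S_1,\dots,S_n$, the sum $\sum_{k\in\mathbb Z_2^n}p_{0,0}^{S^kP}$ is learnable under the first-order approximation; that is, the function $\mathcal N\mapsto\sum_{k\in\mathbb Z_2^n}\hat p_{0,0}^{S^kP}$ is learnable, and it agrees with $\sum_{k}p_{0,0}^{S^kP}$ up to second order in the noise: if $\varepsilon=1-p_{0,0}^I\le\frac14$, then $\bigl|\sum_k p_{0,0}^{S^kP}-\sum_k\hat p_{0,0}^{S^kP}\bigr|\le 4\cdot2^n\varepsilon^2$. -/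

import Mathlib

namespace MCM

noncomputable section

open Matrix
open scoped ComplexOrder

/-! ### Pauli operators and gates on a finite set `ι` of qubits -/

/-- Operators on the qubits indexed by `ι`, in the computational basis `ℤ₂^ι`. -/
abbrev Op (ι : Type*) := Matrix (ι → ZMod 2) (ι → ZMod 2) ℂ

/-- Pauli operators modulo phase: the qubit `i` carries `I`, `X`, `Y` or `Z` according to
`P i = (0,0)`, `(1,0)`, `(1,1)`, `(0,1)`. Addition is multiplication modulo phase. -/
abbrev Pauli (ι : Type*) := ι → ZMod 2 × ZMod 2

/-- The sign `(-1)^z` of a bit `z`. -/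
def sgn (z : ZMod 2) : ℝ := (-1) ^ z.val

/-- Tensor product of single-qubit operators. -/
def tensor {ι : Type*} [Fintype ι] (A : ι → Matrix (ZMod 2) (ZMod 2) ℂ) : Op ι :=
  fun r c => ∏ i, A i (r i) (c i)

/-- The single-qubit Pauli matrix `i^{xz} X^x Z^z`, that is, `I`, `X`, `Y`, `Z`. -/
def pauli1 (p : ZMod 2 × ZMod 2) : Matrix (ZMod 2) (ZMod 2) ℂ :=
  fun r c =>
    if r = c + p.1 then Complex.I ^ (p.1.val * p.2.val) * (-1) ^ (p.2.val * c.val) else 0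

/-- The matrix of a Pauli operator. -/
def pauliMat {ι : Type*} [Fintype ι] (P : Pauli ι) : Op ι := tensor fun i => pauli1 (P i)

/-- `⟨P, Q⟩`, the binary symplectic form: `0` if `P` and `Q` commute and `1` otherwise. -/
def pauliInner {ι : Type*} [Fintype ι] (P Q : Pauli ι) : ZMod 2 :=
  ∑ i, ((P i).1 * (Q i).2 + (P i).2 * (Q i).1)

/-- The Pauli weight pattern: `0` where `P` acts as the identity and `1` elsewhere. -/
def pattern {ι : Type*} (P : Pauli ι) : ι → ZMod 2 := fun i => if P i = 0 then 0 else 1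

/-- Clifford gates: unitaries that map Pauli operators to Pauli operators up to sign. -/
def IsClifford {ι : Type*} [Fintype ι] [DecidableEq ι] (U : Op ι) : Prop :=
  U ∈ Matrix.unitaryGroup (ι → ZMod 2) ℂ ∧
    ∀ P : Pauli ι, ∃ Q : Pauli ι,
      U * pauliMat P * Uᴴ = pauliMat Q ∨ U * pauliMat P * Uᴴ = -pauliMat Q

/-! ### Pauli channels -/

/-- The Pauli fidelity `∑_P (-1)^⟨P,Q⟩ p^P` of the Pauli channel with error rates `p`. -/
def pauliFidelity {ι : Type*} [Fintype ι] [DecidableEq ι] (p : Pauli ι → ℝ) (Q : Pauli ι) : ℝ :=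
  ∑ P, sgn (pauliInner P Q) * p P

/-- A Pauli noise channel in the interior of the polytope of Pauli channels and with positive
Pauli fidelities, given by its error rates. -/
structure PauliNoise (ι : Type*) [Fintype ι] [DecidableEq ι] where
  rate : Pauli ι → ℝ
  rate_pos : ∀ P, 0 < rate P
  rate_sum : ∑ P, rate P = 1
  fidelity_pos : ∀ Q, 0 < pauliFidelity rate Q

/-- The action of a Pauli channel on operators. -/
def PauliNoise.apply {ι : Type*} [Fintype ι] [DecidableEq ι] (Λ : PauliNoise ι) (σ : Op ι) :
    Op ι :=
  ∑ P, (Λ.rate P : ℂ) • (pauliMat P * σ * (pauliMat P)ᴴ)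

/-- A Pauli channel is symmetric if its fidelities depend only on the weight pattern. -/
def PauliNoise.IsSymmetric {ι : Type*} [Fintype ι] [DecidableEq ι] (Λ : PauliNoise ι) : Prop :=
  ∀ P Q : Pauli ι, pattern P = pattern Q → pauliFidelity Λ.rate P = pauliFidelity Λ.rate Q

/-! ### Noise models for mid-circuit measurements

There are `m` unmeasured system qubits (`Sum.inl`) and `n` measured ancilla qubits (`Sum.inr`). -/

/-- The qubits of the device. -/
abbrev Qubits (m n : ℕ) := Fin m ⊕ Fin n

/-- The Pauli fidelities `λ_{x,y}^Q` of a uniform stochastic instrument with Pauli error rates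
`p a b P`. -/
def mcmFidelity {m n : ℕ}
    (p : (Fin n → ZMod 2) → (Fin n → ZMod 2) → Pauli (Fin m) → ℝ)
    (x y : Fin n → ZMod 2) (Q : Pauli (Fin m)) : ℝ :=
  ∑ a, ∑ b, ∑ P, sgn (a ⬝ᵥ x + b ⬝ᵥ y + pauliInner P Q) * p a b P

/-- A noise model: the initial state, the Pauli noise of the available multi-qubit Clifford gates
(labelled by `Γ`), the Pauli error rates of the mid-circuit measurement, and the symmetric Pauli
noise of the terminating measurement. -/
structure NoiseModel (m n : ℕ) (Γ : Type*) where
  /-- the initial state -/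
  state : Op (Qubits m n)
  state_posSemidef : state.PosSemidef
  state_trace : state.trace = 1
  /-- for each weight pattern the state has a nonzero component on some Pauli operator
  of that pattern -/
  state_overlap : ∀ v : Qubits m n → ZMod 2,
    ∃ P : Pauli (Qubits m n), pattern P = v ∧ (pauliMat P * state).trace ≠ 0
  /-- the noise of the multi-qubit Clifford gates -/
  gateNoise : Γ → PauliNoise (Qubits m n)
  /-- the Pauli error rates `p_{a,b}^P` of the mid-circuit measurement -/
  rate : (Fin n → ZMod 2) → (Fin n → ZMod 2) → Pauli (Fin m) → ℝ
  rate_pos : ∀ a b P, 0 < rate a b P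
  rate_sum : ∑ a, ∑ b, ∑ P, rate a b P = 1
  fidelity_pos : ∀ x y Q, 0 < mcmFidelity rate x y Q
  /-- the noise of the terminating measurement -/
  termNoise : PauliNoise (Qubits m n)
  termNoise_symmetric : termNoise.IsSymmetric

/-- The operator `P ⊗ |r⟩⟨s|`. -/
def kraus {m n : ℕ} (P : Pauli (Fin m)) (r s : Fin n → ZMod 2) : Op (Qubits m n) :=
  fun u v =>
    if u ∘ Sum.inr = r ∧ v ∘ Sum.inr = s then pauliMat P (u ∘ Sum.inl) (v ∘ Sum.inl) else 0

/-- The unnormalized output state of the noisy mid-circuit measurement with ideal gate `G`, on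
the readout `k`: the ideal gate followed by the uniform stochastic instrument. -/
def NoiseModel.mcm {m n : ℕ} {Γ : Type*} (N : NoiseModel m n Γ) (G : Op (Qubits m n))
    (k : Fin n → ZMod 2) (σ : Op (Qubits m n)) : Op (Qubits m n) :=
  ∑ a, ∑ b, ∑ P, (N.rate a b P : ℂ) •
    (kraus P (k + b) (k + a) * (G * σ * Gᴴ) * (kraus P (k + b) (k + a))ᴴ)

/-! ### Experiments and learnability -/

/-- The steps of a circuit: a layer of single-qubit gates, a multi-qubit Clifford gate from the
gate set, or a mid-circuit measurement. -/
inductive Step (m n : ℕ) (Γ : Type*) where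
  | layer (U : Qubits m n → Matrix.unitaryGroup (ZMod 2) ℂ)
  | gate (g : Γ)
  | measure

/-- The unnormalized state after a noisy circuit that is run on `σ`, on the record of readouts
given by the list (zero if the list does not have one readout for each measurement). Layers of
single-qubit gates are noiseless. -/
def NoiseModel.run {m n : ℕ} {Γ : Type*} (N : NoiseModel m n Γ) (G : Op (Qubits m n))
    (gates : Γ → Op (Qubits m n)) :
    List (Step m n Γ) → List (Fin n → ZMod 2) → Op (Qubits m n) → Op (Qubits m n)
  | [], [], σ => σ
  | [], _ :: _, _ => 0
  | Step.layer U :: c, ks, σ =>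
      N.run G gates c ks
        (tensor (fun i => (U i).1) * σ * (tensor (fun i => (U i).1))ᴴ)
  | Step.gate g :: c, ks, σ =>
      N.run G gates c ks ((N.gateNoise g).apply (gates g * σ * (gates g)ᴴ))
  | Step.measure :: _, [], _ => 0
  | Step.measure :: c, k :: ks, σ => N.run G gates c ks (N.mcm G k σ)

/-- Positive operator-valued measures with `r` outcomes. -/
def IsPOVM {ι : Type*} [Fintype ι] [DecidableEq ι] {r : ℕ} (F : Fin r → Op ι) : Prop :=
  (∀ j, (F j).PosSemidef) ∧ ∑ j, F j = 1

/-- The probability of the readouts `ks` and the terminating outcome `j` in the experiment that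
prepares the initial state, runs the circuit `c` and performs the terminating measurement `F`. -/
def NoiseModel.prob {m n : ℕ} {Γ : Type*} (N : NoiseModel m n Γ) (G : Op (Qubits m n))
    (gates : Γ → Op (Qubits m n)) (c : List (Step m n Γ)) {r : ℕ}
    (F : Fin r → Op (Qubits m n)) (ks : List (Fin n → ZMod 2)) (j : Fin r) : ℝ :=
  (F j * N.termNoise.apply (N.run G gates c ks N.state)).trace.re

/-- Two noise models are indistinguishable if every experiment has the same outcome distribution
under both. -/
def Indistinguishable {m n : ℕ} {Γ : Type*} (G : Op (Qubits m n)) (gates : Γ → Op (Qubits m n))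
    (N₁ N₂ : NoiseModel m n Γ) : Prop :=
  ∀ (c : List (Step m n Γ)) (r : ℕ) (F : Fin r → Op (Qubits m n)), IsPOVM F →
    ∀ (ks : List (Fin n → ZMod 2)) (j : Fin r),
      N₁.prob G gates c F ks j = N₂.prob G gates c F ks j

/-- A function of the noise model is learnable if it agrees on indistinguishable models. -/
def Learnable {m n : ℕ} {Γ : Type*} (G : Op (Qubits m n)) (gates : Γ → Op (Qubits m n))
    (f : NoiseModel m n Γ → ℝ) : Prop :=
  ∀ N₁ N₂ : NoiseModel m n Γ, Indistinguishable G gates N₁ N₂ → f N₁ = f N₂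

/-- The first-order approximation of the Pauli error rate `p_{a,b}^P`: in the inverse Fourier
transform of the fidelities, `λ` is replaced by `1 + log λ`. -/
def NoiseModel.firstOrderRate {m n : ℕ} {Γ : Type*} (N : NoiseModel m n Γ)
    (a b : Fin n → ZMod 2) (P : Pauli (Fin m)) : ℝ :=
  (1 / 4 ^ (n + m)) * ∑ x : Fin n → ZMod 2, ∑ y : Fin n → ZMod 2, ∑ Q : Pauli (Fin m),
    sgn (a ⬝ᵥ x + b ⬝ᵥ y + pauliInner P Q) * (1 + Real.log (mcmFidelity N.rate x y Q))

/-! ### Syndrome measurements -/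

/-- The Hadamard matrix. -/
def hadamard1 : Matrix (ZMod 2) (ZMod 2) ℂ :=
  fun r c => (-1) ^ (r.val * c.val) / (Real.sqrt 2 : ℂ)

/-- The projection `|b⟩⟨b|` on one qubit. -/
def proj1 (b : ZMod 2) : Matrix (ZMod 2) (ZMod 2) ℂ := fun r c => if r = b ∧ c = b then 1 else 0

/-- The Hadamard gate on the `i`-th ancilla. -/
def hadamardAt {m n : ℕ} (i : Fin n) : Op (Qubits m n) :=
  tensor (Function.update (fun _ => 1) (Sum.inr i) hadamard1)

/-- The gate controlled-`S`, with the `i`-th ancilla as control and the system as target. -/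
def controlled {m n : ℕ} (S : Pauli (Fin m)) (i : Fin n) : Op (Qubits m n) :=
  tensor (Function.update (fun _ => 1) (Sum.inr i) (proj1 0)) +
    tensor (Function.update (Sum.elim (fun j => pauli1 (S j)) (fun _ => 1)) (Sum.inr i) (proj1 1))

/-- The syndrome extraction circuit for `S₁, …, Sₙ`: for each `i` in turn, a Hadamard gate on the
`i`-th ancilla, controlled-`Sᵢ`, and the Hadamard gate again. -/
def syndromeGate {m n : ℕ} (S : Fin n → Pauli (Fin m)) : Op (Qubits m n) :=
  (List.ofFn fun i => hadamardAt i * controlled (S i) i * hadamardAt i).reverse.prod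

/-- `S^k`, the product of the `Sᵢ` with `kᵢ = 1`, modulo phase. -/
def stabPow {m n : ℕ} (S : Fin n → Pauli (Fin m)) (k : Fin n → ZMod 2) : Pauli (Fin m) :=
  ∑ i, k i • S i

end

end MCM

namespace MCM

open Matrix

/-! ### Signs and Fourier inversion -/

/-! Work in the Heisenberg picture. Summing over the readouts `k` of a noisy MCM with the sign
`(-1)^((u+v)·k)` turns the observable `Q ⊗ Z^v` into `λ_{u,v}^Q` times the ideal-gate pullback of `Q
⊗ Z^u` (`NoiseModel.sum_trace_mcm`). If `Q` commutes with every `Sᵢ`, that pullback is a nonzero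
real multiple of `(Q + S^u) ⊗ Z^u` (`syndromeGate_conj`). Four MCMs with labels alternating between
`u` and `v` add each of `S^u` and `S^v` twice, so `Q ⊗ Z^u` returns to itself. Dividing by the
experiment without MCMs cancels preparation and readout errors and leaves a product of four
fidelities, `cycleFidelity`, which is therefore learnable (`Indistinguishable.cycleFidelity_eq`).

The Fourier weight `cosetWeight` of the coset of `P` vanishes unless `Q` commutes with all `Sᵢ`, and
it is invariant under `Q ↦ Q + S^u`. Hence only learnable cycles occur, and the weighted sum of
their logarithms is four times the weighted sum of all `log λ` (`NoiseModel.four_mul_sum_log`). This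
is the only part of the first-order coset sum that depends on the model.

For the error bound, every fidelity lies in `[1 - 2ε, 1]`, where `λ` and `1 + log λ` differ by at
most `4ε²`. Inverse Fourier transformation averages these errors with signs, so each of the `2^n`
rates inherits the same bound. -/

lemma sgn_zero : sgn 0 = 1 := by simp [sgn]

lemma sgn_add (a b : ZMod 2) : sgn (a + b) = sgn a * sgn b := by
  have h : ∀ a b : ZMod 2, ((a + b).val + a.val + b.val) % 2 = 0 := by decide
  have h1 : sgn (a + b) * (sgn a * sgn b) = 1 := by
    rw [sgn, sgn, sgn, ← mul_assoc, ← pow_add, ← pow_add]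
    exact Even.neg_one_pow (Nat.even_iff.2 (h a b))
  have h2 : (sgn a * sgn b) * (sgn a * sgn b) = 1 := by
    rw [sgn, sgn, ← pow_add, ← pow_add]
    exact Even.neg_one_pow ⟨_, rfl⟩
  calc sgn (a + b) = sgn (a + b) * ((sgn a * sgn b) * (sgn a * sgn b)) := by rw [h2, mul_one]
    _ = _ := by rw [← mul_assoc, h1, one_mul]

lemma sgn_eq (a : ZMod 2) : sgn a = if a = 0 then 1 else -1 := by
  have h : ∀ a : ZMod 2, a = 0 ∧ a.val = 0 ∨ a ≠ 0 ∧ a.val = 1 := by decide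
  rcases h a with ⟨h1, h2⟩ | ⟨h1, h2⟩ <;> simp [sgn, h1, h2]

lemma abs_sgn (a : ZMod 2) : |sgn a| = 1 := by
  rw [sgn_eq]; split_ifs <;> norm_num

lemma sgn_sum {ι : Type*} (s : Finset ι) (f : ι → ZMod 2) :
    sgn (∑ i ∈ s, f i) = ∏ i ∈ s, sgn (f i) := by
  classical
  induction s using Finset.induction_on with
  | empty => simp [sgn_zero]
  | insert i s hi ih => rw [Finset.sum_insert hi, Finset.prod_insert hi, sgn_add, ih]

lemma sum_sgn_hom {A : Type*} [AddCommGroup A] [Fintype A] (f : A →+ ZMod 2) [Decidable (f = 0)] :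
    ∑ a, sgn (f a) = if f = 0 then (Fintype.card A : ℝ) else 0 := by
  split_ifs with h
  · simp [h, sgn_zero]
  · obtain ⟨k, hk⟩ : ∃ k, f k ≠ 0 := by
      by_contra! H
      exact h (AddMonoidHom.ext H)
    have h1 : ∑ a, sgn (f (a + k)) = ∑ a, sgn (f a) :=
      Fintype.sum_equiv (Equiv.addRight k) _ _ fun _ => rfl
    have h2 : ∑ a, sgn (f (a + k)) = - ∑ a, sgn (f a) := by
      rw [← Finset.sum_neg_distrib]
      refine Finset.sum_congr rfl fun a _ => ?_
      rw [map_add, sgn_add, sgn_eq (f k), if_neg hk, mul_neg_one]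
    linarith

/-- Orthogonality of characters: in a group of exponent two, `B a x + B c x = B (a + c) x`, which by
nondegeneracy is trivial in `x` only for `c = a`. -/
lemma fourier_inversion {A : Type*} [AddCommGroup A] [Fintype A] (B : A →+ A →+ ZMod 2)
    (hB : ∀ a, B a = 0 → a = 0) (hA : ∀ a : A, a + a = 0) (p : A → ℝ) (a : A) :
    ∑ x, sgn (B a x) * ∑ c, sgn (B c x) * p c = Fintype.card A * p a := by
  classical
  simp_rw [Finset.mul_sum]
  rw [Finset.sum_comm]
  have h : ∀ c, ∑ x, sgn (B a x) * (sgn (B c x) * p c)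
      = if c = a then (Fintype.card A : ℝ) * p a else 0 := by
    intro c
    have : ∑ x, sgn (B a x) * (sgn (B c x) * p c) = (∑ x, sgn (B (a + c) x)) * p c := by
      rw [Finset.sum_mul]
      refine Finset.sum_congr rfl fun x _ => ?_
      rw [map_add, AddMonoidHom.add_apply, sgn_add]; ring
    rw [this, sum_sgn_hom]
    by_cases hc : c = a
    · subst hc
      simp [hA]
    · have : B (a + c) ≠ 0 := fun h0 => hc <| by
        have h1 := hB _ h0
        have h2 := hA a
        rw [← h2] at h1
        exact add_left_cancel h1
      rw [if_neg this, if_neg hc, zero_mul]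
  simp_rw [h]
  simp

/-! ### The symplectic form -/

lemma pauliInner_add_left {ι : Type*} [Fintype ι] (P P' Q : Pauli ι) :
    pauliInner (P + P') Q = pauliInner P Q + pauliInner P' Q := by
  simp only [pauliInner, ← Finset.sum_add_distrib, Pi.add_apply, Prod.fst_add, Prod.snd_add]
  exact Finset.sum_congr rfl fun _ _ => by ring

lemma pauliInner_comm {ι : Type*} [Fintype ι] (P Q : Pauli ι) :
    pauliInner P Q = pauliInner Q P :=
  Finset.sum_congr rfl fun _ _ => by ring

lemma pauliInner_add_right {ι : Type*} [Fintype ι] (P Q Q' : Pauli ι) :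
    pauliInner P (Q + Q') = pauliInner P Q + pauliInner P Q' := by
  rw [pauliInner_comm, pauliInner_add_left, pauliInner_comm Q, pauliInner_comm Q']

/-- The bicharacter exponent that defines the fidelities of the mid-circuit measurement. -/
def mcmForm (m n : ℕ) :
    ((Fin n → ZMod 2) × (Fin n → ZMod 2) × Pauli (Fin m)) →+
      ((Fin n → ZMod 2) × (Fin n → ZMod 2) × Pauli (Fin m)) →+ ZMod 2 :=
  AddMonoidHom.mk' (fun a => AddMonoidHom.mk'
      (fun x => a.1 ⬝ᵥ x.1 + a.2.1 ⬝ᵥ x.2.1 + pauliInner a.2.2 x.2.2) (by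
        intro x y
        simp only [Prod.fst_add, Prod.snd_add, dotProduct_add, pauliInner_add_right]
        ring)) (by
    intro x y
    ext z
    simp only [Prod.fst_add, Prod.snd_add, add_dotProduct, pauliInner_add_left,
      AddMonoidHom.mk'_apply, AddMonoidHom.add_apply]
    ring)

lemma mcmForm_apply {m n : ℕ} (a x : (Fin n → ZMod 2) × (Fin n → ZMod 2) × Pauli (Fin m)) :
    mcmForm m n a x = a.1 ⬝ᵥ x.1 + a.2.1 ⬝ᵥ x.2.1 + pauliInner a.2.2 x.2.2 := rfl

lemma pauli_eq_zero_of_pauliInner {ι : Type*} [Fintype ι] (P : Pauli ι)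
    (h : ∀ Q, pauliInner P Q = 0) : P = 0 := by
  classical
  funext i
  have h1 := h (Pi.single i (0, 1))
  have h2 := h (Pi.single i (1, 0))
  simp only [pauliInner] at h1 h2
  rw [Finset.sum_eq_single i (by intro j _ hj; simp [hj]) (by simp)] at h1 h2
  simp at h1 h2
  exact Prod.ext h1 h2

lemma mcmForm_nondegenerate {m n : ℕ} (a : (Fin n → ZMod 2) × (Fin n → ZMod 2) × Pauli (Fin m))
    (h : mcmForm m n a = 0) : a = 0 := by
  have H : ∀ x, mcmForm m n a x = 0 := fun x => by rw [h]; rfl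
  simp only [mcmForm_apply, Prod.forall] at H
  refine Prod.ext ?_ (Prod.ext ?_ ?_)
  · funext i
    simpa [pauliInner] using H (Pi.single i 1) 0 0
  · funext i
    simpa [pauliInner] using H 0 (Pi.single i 1) 0
  · exact pauli_eq_zero_of_pauliInner _ fun Q => by simpa using H 0 0 Q

lemma card_mcmForm (m n : ℕ) :
    (Fintype.card ((Fin n → ZMod 2) × (Fin n → ZMod 2) × Pauli (Fin m)) : ℝ) = 4 ^ (n + m) := by
  simp only [Fintype.card_prod, Fintype.card_pi, ZMod.card, Finset.prod_const, Finset.card_univ,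
    Fintype.card_fin]
  push_cast
  rw [pow_add, show (4 : ℝ) = 2 * 2 by norm_num, mul_pow 2 2 n]
  ring

lemma mcmFidelity_eq {m n : ℕ} (p : (Fin n → ZMod 2) → (Fin n → ZMod 2) → Pauli (Fin m) → ℝ)
    (x : (Fin n → ZMod 2) × (Fin n → ZMod 2) × Pauli (Fin m)) :
    mcmFidelity p x.1 x.2.1 x.2.2 =
      ∑ a, sgn (mcmForm m n a x) * p a.1 a.2.1 a.2.2 := by
  simp [mcmFidelity, Fintype.sum_prod_type, mcmForm_apply]

lemma rate_eq_sum_mcmFidelity {m n : ℕ}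
    (p : (Fin n → ZMod 2) → (Fin n → ZMod 2) → Pauli (Fin m) → ℝ)
    (a b : Fin n → ZMod 2) (P : Pauli (Fin m)) :
    p a b P = (1 / 4 ^ (n + m)) * ∑ x : Fin n → ZMod 2, ∑ y : Fin n → ZMod 2,
      ∑ Q : Pauli (Fin m), sgn (a ⬝ᵥ x + b ⬝ᵥ y + pauliInner P Q) * mcmFidelity p x y Q := by
  have h := fourier_inversion (mcmForm m n) mcmForm_nondegenerate
    (fun a => by ext <;> simp [CharTwo.add_self_eq_zero])
    (fun a => p a.1 a.2.1 a.2.2) (a, b, P)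
  simp_rw [← mcmFidelity_eq] at h
  rw [card_mcmForm] at h
  simp only [Fintype.sum_prod_type, mcmForm_apply] at h
  rw [h]
  field_simp

/-! ### The first-order approximation -/

variable {m n : ℕ} {Γ : Type*}

lemma NoiseModel.sum_rate (N : NoiseModel m n Γ) :
    ∑ a : (Fin n → ZMod 2) × (Fin n → ZMod 2) × Pauli (Fin m), N.rate a.1 a.2.1 a.2.2 = 1 := by
  simpa [Fintype.sum_prod_type] using N.rate_sum

lemma NoiseModel.mcmFidelity_le_one (N : NoiseModel m n Γ) (x y : Fin n → ZMod 2)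
    (Q : Pauli (Fin m)) : mcmFidelity N.rate x y Q ≤ 1 := by
  rw [mcmFidelity_eq N.rate (x, y, Q), ← N.sum_rate]
  refine Finset.sum_le_sum fun a _ => ?_
  have := le_of_abs_le (abs_sgn (mcmForm m n a (x, y, Q))).le
  nlinarith [N.rate_pos a.1 a.2.1 a.2.2]

/-- In `λ + 1 = ∑ (sign + 1) p` all terms are nonnegative, and the error-free term alone contributes
`2 p_{0,0}^I`. -/
lemma NoiseModel.le_mcmFidelity (N : NoiseModel m n Γ) (x y : Fin n → ZMod 2)
    (Q : Pauli (Fin m)) : 1 - 2 * (1 - N.rate 0 0 0) ≤ mcmFidelity N.rate x y Q := by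
  have h : ∑ a : (Fin n → ZMod 2) × (Fin n → ZMod 2) × Pauli (Fin m),
      (sgn (mcmForm m n a (x, y, Q)) + 1) * N.rate a.1 a.2.1 a.2.2 ≥ 2 * N.rate 0 0 0 := by
    have h0 := Finset.single_le_sum (f := fun a => (sgn (mcmForm m n a (x, y, Q)) + 1) *
      N.rate a.1 a.2.1 a.2.2) (s := Finset.univ) (fun a _ => by
        have := neg_le_of_abs_le (abs_sgn (mcmForm m n a (x, y, Q))).le
        exact mul_nonneg (by linarith) (N.rate_pos a.1 a.2.1 a.2.2).le) (Finset.mem_univ 0)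
    simp only [map_zero, AddMonoidHom.zero_apply, sgn_zero, Prod.fst_zero, Prod.snd_zero] at h0
    linarith
  simp_rw [add_mul, one_mul, Finset.sum_add_distrib] at h
  rw [N.sum_rate, ← mcmFidelity_eq N.rate (x, y, Q)] at h
  linarith

lemma abs_sub_one_add_log_le {l e : ℝ} (h1 : l ≤ 1) (h2 : 1 - 2 * e ≤ l) (he : e ≤ 1 / 4) :
    |l - (1 + Real.log l)| ≤ 4 * e ^ 2 := by
  have hl : 1 / 2 ≤ l := by linarith
  have hpos : 0 < l := by linarith
  have h3 := Real.log_le_sub_one_of_pos hpos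
  rw [abs_of_nonneg (by linarith)]
  obtain ⟨t, rfl⟩ : ∃ t, l = 1 - t := ⟨1 - l, by ring⟩
  have ht : 0 ≤ t := by linarith
  have ht' : t ≤ 1 / 2 := by linarith
  -- With `t ≤ 1/2`, four Taylor terms of `log (1 - t)` suffice: in units of `t²` the error is at
  -- most `1/2 + 1/6 + 1/16 + 1/4 < 1`, the last summand bounding the remainder.
  have h4 := neg_le_of_abs_le (Real.abs_log_sub_add_sum_range_le (x := t)
    (by rw [abs_of_nonneg ht]; linarith) 4)
  rw [abs_of_nonneg ht] at h4
  have h5 : t ^ (4 + 1) / (1 - t) ≤ t ^ 2 * (1 / 4) := by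
    rw [div_le_iff₀ hpos]
    have h6 : t ^ 3 ≤ (1 / 2) ^ 3 := pow_le_pow_left₀ ht ht' 3
    nlinarith [mul_nonneg (sq_nonneg t) (by linarith : 0 ≤ 1 / 8 - t ^ 3),
      mul_nonneg (sq_nonneg t) (by linarith : 0 ≤ 1 / 2 - t)]
  have h7 : t ^ 3 ≤ t ^ 2 * (1 / 2) := by nlinarith [sq_nonneg t]
  have h8 : t ^ 4 ≤ t ^ 2 * (1 / 4) := by nlinarith [sq_nonneg t]
  have h9 : t ^ 2 ≤ (2 * e) ^ 2 := pow_le_pow_left₀ ht (by linarith) 2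
  simp only [Finset.sum_range_succ, Finset.sum_range_zero] at h4
  norm_num at h4
  nlinarith [sq_nonneg t]

lemma NoiseModel.abs_rate_sub_firstOrderRate_le (N : NoiseModel m n Γ)
    (hN : 1 - N.rate 0 0 0 ≤ 1 / 4) (a b : Fin n → ZMod 2) (P : Pauli (Fin m)) :
    |N.rate a b P - N.firstOrderRate a b P| ≤ 4 * (1 - N.rate 0 0 0) ^ 2 := by
  rw [rate_eq_sum_mcmFidelity N.rate a b P, firstOrderRate, ← mul_sub]
  simp_rw [← Finset.sum_sub_distrib, ← mul_sub]
  rw [abs_mul, abs_of_pos (by positivity : (0 : ℝ) < 1 / 4 ^ (n + m))]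
  have h : |∑ x : Fin n → ZMod 2, ∑ y : Fin n → ZMod 2, ∑ Q : Pauli (Fin m),
      sgn (a ⬝ᵥ x + b ⬝ᵥ y + pauliInner P Q) *
        (mcmFidelity N.rate x y Q - (1 + Real.log (mcmFidelity N.rate x y Q)))| ≤
      ∑ x : (Fin n → ZMod 2) × (Fin n → ZMod 2) × Pauli (Fin m),
        4 * (1 - N.rate 0 0 0) ^ 2 := by
    have h0 : ∀ f : (Fin n → ZMod 2) → (Fin n → ZMod 2) → Pauli (Fin m) → ℝ,
        ∑ x, ∑ y, ∑ Q, f x y Q = ∑ z : (Fin n → ZMod 2) × (Fin n → ZMod 2) × Pauli (Fin m),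
          f z.1 z.2.1 z.2.2 := fun f => by simp [Fintype.sum_prod_type]
    rw [h0]
    refine (Finset.abs_sum_le_sum_abs _ _).trans (Finset.sum_le_sum fun z _ => ?_)
    rw [abs_mul, abs_sgn, one_mul]
    exact abs_sub_one_add_log_le (N.mcmFidelity_le_one _ _ _) (N.le_mcmFidelity _ _ _) hN
  rw [Finset.sum_const, nsmul_eq_mul, Finset.card_univ, card_mcmForm] at h
  rw [one_div, inv_mul_le_iff₀ (by positivity)]
  exact h

/-! ### Pauli matrices on one qubit -/

lemma zmod_two_cases (a : ZMod 2) : a = 0 ∨ a = 1 := by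
  revert a; decide

lemma zmod_two_one_add_one : (1 : ZMod 2) + 1 = 0 := rfl

lemma zmod_two_val_one : (1 : ZMod 2).val = 1 := rfl

lemma sum_zmod_two {M : Type*} [AddCommMonoid M] (f : ZMod 2 → M) : ∑ a, f a = f 0 + f 1 :=
  Fin.sum_univ_two f

lemma pauli1_zero : pauli1 0 = 1 := by
  ext r c
  simp [pauli1, Matrix.one_apply]

lemma pauli1_conjTranspose (p : ZMod 2 × ZMod 2) : (pauli1 p)ᴴ = pauli1 p := by
  obtain ⟨x, z⟩ := p
  ext r c
  rw [Matrix.conjTranspose_apply]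
  rcases zmod_two_cases x with rfl | rfl <;> rcases zmod_two_cases z with rfl | rfl <;>
    rcases zmod_two_cases r with rfl | rfl <;> rcases zmod_two_cases c with rfl | rfl <;>
    simp [pauli1, zmod_two_one_add_one, zmod_two_val_one]

lemma pauli1_comm (p q : ZMod 2 × ZMod 2) :
    pauli1 p * pauli1 q = (sgn (p.1 * q.2 + p.2 * q.1) : ℂ) • (pauli1 q * pauli1 p) := by
  obtain ⟨x, z⟩ := p
  obtain ⟨x', z'⟩ := q
  ext r c
  simp only [Matrix.mul_apply, Matrix.smul_apply, sum_zmod_two]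
  rcases zmod_two_cases x with rfl | rfl <;> rcases zmod_two_cases z with rfl | rfl <;>
    rcases zmod_two_cases x' with rfl | rfl <;> rcases zmod_two_cases z' with rfl | rfl <;>
    rcases zmod_two_cases r with rfl | rfl <;> rcases zmod_two_cases c with rfl | rfl <;>
    simp [pauli1, sgn, zmod_two_one_add_one, zmod_two_val_one]

lemma pauli1_mul_self (p : ZMod 2 × ZMod 2) : pauli1 p * pauli1 p = 1 := by
  obtain ⟨x, z⟩ := p
  ext r c
  simp only [Matrix.mul_apply, sum_zmod_two]
  rcases zmod_two_cases x with rfl | rfl <;> rcases zmod_two_cases z with rfl | rfl <;>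
    rcases zmod_two_cases r with rfl | rfl <;> rcases zmod_two_cases c with rfl | rfl <;>
    simp [pauli1, zmod_two_one_add_one, zmod_two_val_one]

lemma I_pow_four : Complex.I ^ 4 = 1 := by
  rw [show 4 = 2 * 2 from rfl, pow_mul, Complex.I_sq]; norm_num

lemma I_pow_five : Complex.I ^ 5 = Complex.I := by
  rw [pow_succ, I_pow_four, one_mul]

/-- The square of the phase is recorded because it multiplies over qubits to the commutation sign;
commuting Pauli operators then have phase `±1`, which is real. -/
lemma pauli1_mul (p q : ZMod 2 × ZMod 2) : ∃ c : ℂ,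
    c ^ 2 = (sgn (p.1 * q.2 + p.2 * q.1) : ℂ) ∧ pauli1 p * pauli1 q = c • pauli1 (p + q) := by
  obtain ⟨x, z⟩ := p
  obtain ⟨x', z'⟩ := q
  -- The exponent collects the normalizations of the two factors, the sign `i^(2zx')` from moving
  -- `Z^z` past `X^x'`, and the inverse `i^3 = i⁻¹` of the normalization of the product.
  refine ⟨Complex.I ^ (x.val * z.val + x'.val * z'.val + 2 * (z.val * x'.val) +
    3 * ((x + x').val * (z + z').val)), ?_, ?_⟩
  · rcases zmod_two_cases x with rfl | rfl <;> rcases zmod_two_cases z with rfl | rfl <;>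
      rcases zmod_two_cases x' with rfl | rfl <;> rcases zmod_two_cases z' with rfl | rfl <;>
      simp [sgn, zmod_two_one_add_one, zmod_two_val_one, I_pow_five]
  · ext r c
    simp only [Matrix.mul_apply, Matrix.smul_apply, sum_zmod_two]
    rcases zmod_two_cases x with rfl | rfl <;> rcases zmod_two_cases z with rfl | rfl <;>
      rcases zmod_two_cases x' with rfl | rfl <;> rcases zmod_two_cases z' with rfl | rfl <;>
      rcases zmod_two_cases r with rfl | rfl <;> rcases zmod_two_cases c with rfl | rfl <;>
      simp [pauli1, zmod_two_one_add_one, zmod_two_val_one, Complex.I_pow_three, I_pow_five]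

lemma pauli1_anticomm {p q : ZMod 2 × ZMod 2} (hp : p ≠ 0) (hq : q ≠ 0) (h : p ≠ q) :
    pauli1 p * pauli1 q = - (pauli1 q * pauli1 p) := by
  have H : ∀ p q : ZMod 2 × ZMod 2, p ≠ 0 → q ≠ 0 → p ≠ q → p.1 * q.2 + p.2 * q.1 ≠ 0 := by
    decide
  rw [pauli1_comm, sgn_eq, if_neg (H p q hp hq h)]
  simp

/-- Distinct non-identity Pauli matrices `p`, `q` anticommute, so `W = (p + q)/√2` is a self-adjoint
unitary, and `q W = W p`. -/
lemma exists_unitary_conj_pauli1 {p q : ZMod 2 × ZMod 2} (h : p = 0 ↔ q = 0) :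
    ∃ U : Matrix.unitaryGroup (ZMod 2) ℂ, (U.1)ᴴ * pauli1 q * U.1 = pauli1 p := by
  by_cases hpq : p = q
  · exact ⟨1, by simp [hpq]⟩
  have hp : p ≠ 0 := fun h0 => hpq (by rw [h0, h.1 h0])
  have hq : q ≠ 0 := fun h0 => hp (h.2 h0)
  have ha := pauli1_anticomm hp hq hpq
  have hpp := pauli1_mul_self p
  have hqq := pauli1_mul_self q
  have hs : ((Real.sqrt 2 : ℂ)⁻¹) * (Real.sqrt 2 : ℂ)⁻¹ = 1 / 2 := by
    rw [← mul_inv, ← Complex.ofReal_mul, Real.mul_self_sqrt (by norm_num)]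
    norm_num
  set W : Matrix (ZMod 2) (ZMod 2) ℂ := (Real.sqrt 2 : ℂ)⁻¹ • (pauli1 p + pauli1 q) with hW
  have hWh : Wᴴ = W := by
    simp [hW, Matrix.conjTranspose_smul, pauli1_conjTranspose]
  have hWW : W * W = 1 := by
    rw [hW, smul_mul_smul_comm, hs, add_mul, mul_add, mul_add, hpp, hqq, ha]
    rw [show (1 : Matrix (ZMod 2) (ZMod 2) ℂ) + -(pauli1 q * pauli1 p) + (pauli1 q * pauli1 p + 1)
      = (2 : ℂ) • 1 by rw [two_smul]; abel, smul_smul]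
    norm_num
  refine ⟨⟨W, ?_⟩, ?_⟩
  · rw [Matrix.mem_unitaryGroup_iff, Matrix.star_eq_conjTranspose, hWh, hWW]
  · change Wᴴ * pauli1 q * W = pauli1 p
    have : pauli1 q * W = W * pauli1 p := by
      rw [hW, mul_smul_comm, smul_mul_assoc, mul_add, add_mul, hpp, hqq, add_comm]
    rw [hWh, mul_assoc, this, ← mul_assoc, hWW, one_mul]

/-! ### Tensor products and Pauli operators -/

section Tensor

variable {ι : Type*} [Fintype ι]

lemma tensor_mul [DecidableEq ι] (A B : ι → Matrix (ZMod 2) (ZMod 2) ℂ) :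
    tensor A * tensor B = tensor fun i => A i * B i := by
  ext r c
  simp only [Matrix.mul_apply, tensor, ← Finset.prod_mul_distrib]
  rw [Finset.prod_univ_sum, Fintype.piFinset_univ]

lemma tensor_conjTranspose (A : ι → Matrix (ZMod 2) (ZMod 2) ℂ) :
    (tensor A)ᴴ = tensor fun i => (A i)ᴴ := by
  ext r c
  simp [tensor, Matrix.conjTranspose_apply]

lemma tensor_one : tensor (fun _ : ι => 1) = 1 := by
  classical
  ext r c
  simp only [tensor, Matrix.one_apply]
  by_cases h : r = c
  · simp [h]
  · obtain ⟨i, hi⟩ := Function.ne_iff.1 h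
    rw [if_neg h, Finset.prod_eq_zero (Finset.mem_univ i) (if_neg hi)]

lemma tensor_smul (a : ι → ℂ) (A : ι → Matrix (ZMod 2) (ZMod 2) ℂ) :
    tensor (fun i => a i • A i) = (∏ i, a i) • tensor A := by
  ext r c
  simp [tensor, Finset.prod_mul_distrib]

lemma pauliMat_conjTranspose (P : Pauli ι) : (pauliMat P)ᴴ = pauliMat P := by
  simp [pauliMat, tensor_conjTranspose, pauli1_conjTranspose]

variable [DecidableEq ι]

lemma pauliMat_mul_self (P : Pauli ι) : pauliMat P * pauliMat P = 1 := by
  simp [pauliMat, tensor_mul, pauli1_mul_self, tensor_one]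

lemma pauliMat_comm (P Q : Pauli ι) :
    pauliMat P * pauliMat Q = (sgn (pauliInner P Q) : ℂ) • (pauliMat Q * pauliMat P) := by
  simp only [pauliMat, tensor_mul, pauliInner, sgn_sum, Complex.ofReal_prod, ← tensor_smul,
    ← pauli1_comm]

lemma pauliMat_mul (P Q : Pauli ι) : ∃ c : ℂ,
    c ^ 2 = (sgn (pauliInner P Q) : ℂ) ∧ pauliMat P * pauliMat Q = c • pauliMat (P + Q) := by
  choose c h1 h2 using fun i => pauli1_mul (P i) (Q i)
  refine ⟨∏ i, c i, ?_, ?_⟩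
  · simp only [← Finset.prod_pow, h1, pauliInner, sgn_sum, Complex.ofReal_prod]
  · simp only [pauliMat, tensor_mul, h2, tensor_smul, Pi.add_apply]

lemma pauliMat_mul_of_commute {P Q : Pauli ι} (h : pauliInner P Q = 0) : ∃ c : ℝ,
    c ≠ 0 ∧ pauliMat P * pauliMat Q = (c : ℂ) • pauliMat (P + Q) := by
  obtain ⟨c, h1, h2⟩ := pauliMat_mul P Q
  rw [h, sgn_zero, Complex.ofReal_one] at h1
  rcases sq_eq_one_iff.1 h1 with rfl | rfl
  · exact ⟨1, one_ne_zero, by simpa using h2⟩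
  · exact ⟨-1, by norm_num, by simpa using h2⟩

lemma pauliMat_conj (P Q : Pauli ι) :
    pauliMat P * pauliMat Q * pauliMat P = (sgn (pauliInner P Q) : ℂ) • pauliMat Q := by
  rw [pauliMat_comm, smul_mul_assoc, mul_assoc, pauliMat_mul_self, mul_one]

lemma trace_pauliMat_mul_apply (Λ : PauliNoise ι) (Q : Pauli ι) (σ : Op ι) :
    (pauliMat Q * Λ.apply σ).trace = pauliFidelity Λ.rate Q * (pauliMat Q * σ).trace := by
  simp only [PauliNoise.apply, pauliFidelity, Finset.mul_sum, Matrix.trace_sum, mul_smul_comm,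
    Matrix.trace_smul, Complex.ofReal_sum, Finset.sum_mul]
  refine Finset.sum_congr rfl fun P _ => ?_
  rw [pauliMat_conjTranspose, ← mul_assoc, ← mul_assoc, Matrix.trace_mul_comm, ← mul_assoc,
    ← mul_assoc, pauliMat_conj, smul_mul_assoc, Matrix.trace_smul]
  simp only [smul_eq_mul]
  push_cast
  ring

lemma exists_layer_conj_pauliMat {P Q : Pauli ι} (h : pattern P = pattern Q) :
    ∃ U : ι → Matrix.unitaryGroup (ZMod 2) ℂ,
      (tensor fun i => (U i).1)ᴴ * pauliMat Q * (tensor fun i => (U i).1) = pauliMat P := by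
  have h' : ∀ i, P i = 0 ↔ Q i = 0 := fun i => by
    have := congrFun h i
    simp only [pattern] at this
    by_cases h1 : P i = 0 <;> by_cases h2 : Q i = 0 <;> simp_all
  choose U hU using fun i => exists_unitary_conj_pauli1 (h' i)
  exact ⟨U, by simp only [tensor_conjTranspose, pauliMat, tensor_mul, hU]⟩

open scoped ComplexOrder in
lemma posSemidef_half_one_add {O : Op ι} (h : Oᴴ = O) (h2 : O * O = 1) :
    ((1 / 2 : ℂ) • (1 + O)).PosSemidef := by
  have : (1 / 2 : ℂ) • (1 + O) = ((1 / 2 : ℂ) • (1 + O))ᴴ * ((1 / 2 : ℂ) • (1 + O)) := by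
    rw [Matrix.conjTranspose_smul, Matrix.conjTranspose_add, h, Matrix.conjTranspose_one,
      smul_mul_smul_comm, add_mul, mul_add, mul_add, h2, one_mul, mul_one, one_mul,
      show 1 + O + (O + 1) = (2 : ℂ) • (1 + O) by rw [two_smul]; abel, smul_smul]
    congr 1
    simp
  rw [this]
  exact Matrix.posSemidef_conjTranspose_mul_self _

/-- The measurement of an observable with eigenvalues `±1`. -/
noncomputable def observablePOVM (O : Op ι) : Fin 2 → Op ι :=
  ![(1 / 2 : ℂ) • (1 + O), (1 / 2 : ℂ) • (1 - O)]

lemma isPOVM_observablePOVM {O : Op ι} (h : Oᴴ = O) (h2 : O * O = 1) :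
    IsPOVM (observablePOVM O) := by
  refine ⟨fun j => ?_, ?_⟩
  · fin_cases j
    · exact posSemidef_half_one_add h h2
    · have := posSemidef_half_one_add (O := -O) (by simp [h]) (by simp [h2])
      rwa [← sub_eq_add_neg] at this
  · simp only [Fin.sum_univ_two, observablePOVM, Matrix.cons_val_zero, Matrix.cons_val_one]
    rw [← smul_add, show 1 + O + (1 - O) = (2 : ℂ) • 1 by rw [two_smul]; abel, smul_smul]
    norm_num

end Tensor

/-! ### The action of the mid-circuit measurement on observables -/

/-- The operator `A ⊗ |r⟩⟨s|`. -/
def block (A : Op (Fin m)) (r s : Fin n → ZMod 2) : Op (Qubits m n) :=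
  fun a b => if a ∘ Sum.inr = r ∧ b ∘ Sum.inr = s then A (a ∘ Sum.inl) (b ∘ Sum.inl) else 0

lemma kraus_eq_block (P : Pauli (Fin m)) (r s : Fin n → ZMod 2) :
    kraus P r s = block (pauliMat P) r s := rfl

lemma block_conjTranspose (A : Op (Fin m)) (r s : Fin n → ZMod 2) :
    (block A r s)ᴴ = block Aᴴ s r := by
  ext a b
  simp only [Matrix.conjTranspose_apply, block, and_comm (a := b ∘ Sum.inr = r)]
  split_ifs <;> simp

lemma block_smul (z : ℂ) (A : Op (Fin m)) (r s : Fin n → ZMod 2) :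
    block (z • A) r s = z • block A r s := by
  ext a b
  simp [block]

lemma block_mul (A B : Op (Fin m)) (r s s' t : Fin n → ZMod 2) :
    block A r s * block B s' t = if s = s' then block (A * B) r t else 0 := by
  ext a b
  rw [Matrix.mul_apply, ← (Equiv.sumArrowEquivProdArrow (Fin m) (Fin n) (ZMod 2)).symm.sum_comp,
    Fintype.sum_prod_type]
  simp only [block]
  have h1 : ∀ x : (Fin m → ZMod 2) × (Fin n → ZMod 2),
      ((Equiv.sumArrowEquivProdArrow (Fin m) (Fin n) (ZMod 2)).symm x) ∘ Sum.inr = x.2 :=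
    fun _ => rfl
  have h2 : ∀ x : (Fin m → ZMod 2) × (Fin n → ZMod 2),
      ((Equiv.sumArrowEquivProdArrow (Fin m) (Fin n) (ZMod 2)).symm x) ∘ Sum.inl = x.1 :=
    fun _ => rfl
  simp only [h1, h2]
  have h3 : ∀ x y, (if a ∘ Sum.inr = r ∧ y = s then A (a ∘ Sum.inl) x else 0) *
      (if y = s' ∧ b ∘ Sum.inr = t then B x (b ∘ Sum.inl) else 0) =
      if y = s then (if s = s' ∧ a ∘ Sum.inr = r ∧ b ∘ Sum.inr = t then
        A (a ∘ Sum.inl) x * B x (b ∘ Sum.inl) else 0) else 0 := by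
    intro x y
    by_cases hy : y = s
    · subst hy
      by_cases h4 : a ∘ Sum.inr = r <;> by_cases h5 : y = s' <;>
        by_cases h6 : b ∘ Sum.inr = t <;> simp [h4, h5, h6]
    · simp [hy]
  simp only [h3, Finset.sum_ite_eq', Finset.mem_univ, if_true]
  by_cases hs : s = s'
  · simp only [hs, true_and, if_true, block, Matrix.mul_apply]
    split_ifs <;> simp
  · simp [hs]

/-- The Pauli operator `Q ⊗ Z^u`. -/
def ancillaPauli (Q : Pauli (Fin m)) (u : Fin n → ZMod 2) : Pauli (Qubits m n) :=
  Sum.elim Q fun i => (0, u i)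

lemma pauli1_phase (z r c : ZMod 2) :
    pauli1 (0, z) r c = if r = c then (sgn (z * c) : ℂ) else 0 := by
  rcases zmod_two_cases z with rfl | rfl <;> rcases zmod_two_cases r with rfl | rfl <;>
    rcases zmod_two_cases c with rfl | rfl <;> simp [pauli1, sgn, zmod_two_val_one]

lemma pauliMat_ancillaPauli (Q : Pauli (Fin m)) (u : Fin n → ZMod 2) :
    pauliMat (ancillaPauli Q u) = ∑ s, (sgn (u ⬝ᵥ s) : ℂ) • block (pauliMat Q) s s := by
  ext a b
  have h : pauliMat (ancillaPauli Q u) a b = pauliMat Q (a ∘ Sum.inl) (b ∘ Sum.inl) *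
      if a ∘ Sum.inr = b ∘ Sum.inr then (sgn (u ⬝ᵥ (b ∘ Sum.inr)) : ℂ) else 0 := by
    simp only [pauliMat, tensor, Fintype.prod_sum_type, ancillaPauli, Sum.elim_inl, Sum.elim_inr,
      pauli1_phase, Function.comp_apply]
    congr 1
    split_ifs with hab
    · rw [dotProduct, sgn_sum, Complex.ofReal_prod]
      exact Finset.prod_congr rfl fun i _ => if_pos (congrFun hab i)
    · obtain ⟨i, hi⟩ := Function.ne_iff.1 hab
      exact Finset.prod_eq_zero (Finset.mem_univ i) (if_neg hi)
  rw [h, Matrix.sum_apply, Finset.sum_eq_single (b ∘ Sum.inr)]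
  · simp only [Matrix.smul_apply, block, smul_eq_mul, and_true]
    split_ifs <;> simp [mul_comm]
  · intro s _ hs
    simp [block, hs.symm]
  · simp

lemma kraus_conj_ancillaPauli (P Q : Pauli (Fin m)) (v r s : Fin n → ZMod 2) :
    (kraus P r s)ᴴ * pauliMat (ancillaPauli Q v) * kraus P r s =
      (sgn (v ⬝ᵥ r + pauliInner P Q) : ℂ) • block (pauliMat Q) s s := by
  rw [pauliMat_ancillaPauli, kraus_eq_block, block_conjTranspose, pauliMat_conjTranspose]
  simp only [Finset.mul_sum, Finset.sum_mul, mul_smul_comm, smul_mul_assoc, block_mul]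
  rw [Finset.sum_eq_single r]
  · rw [if_pos rfl, block_mul, if_pos rfl, pauliMat_conj, block_smul, smul_smul, sgn_add,
      Complex.ofReal_mul]
  · intro t _ ht
    rw [if_neg ht.symm, zero_mul, smul_zero]
  · simp

/-- Modulo two, `(u+v)·k + v·(k+b) = u·(k+a) + a·u + b·v`. Reindexing by `s = k + a` reassembles
`Z^u` from its diagonal blocks, so the readout sign converts the ancilla label `v` into `u`. -/
lemma sum_kraus_conj_ancillaPauli (P Q : Pauli (Fin m)) (u v a b : Fin n → ZMod 2) :
    ∑ k, (sgn ((u + v) ⬝ᵥ k) : ℂ) •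
      ((kraus P (k + b) (k + a))ᴴ * pauliMat (ancillaPauli Q v) * kraus P (k + b) (k + a)) =
    (sgn (a ⬝ᵥ u + b ⬝ᵥ v + pauliInner P Q) : ℂ) • pauliMat (ancillaPauli Q u) := by
  rw [pauliMat_ancillaPauli Q u, Finset.smul_sum]
  refine Fintype.sum_equiv (Equiv.addRight a) _ _ fun k => ?_
  rw [kraus_conj_ancillaPauli, smul_smul, smul_smul, ← Complex.ofReal_mul, ← Complex.ofReal_mul,
    ← sgn_add, ← sgn_add, Equiv.coe_addRight]
  congr 3
  rw [add_dotProduct, dotProduct_add, dotProduct_add, dotProduct_comm a, dotProduct_comm b]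
  linear_combination CharTwo.add_self_eq_zero (v ⬝ᵥ k) - CharTwo.add_self_eq_zero (u ⬝ᵥ a)

/-- The signs left over from the Kraus operators are the characters defining `λ_{u,v}^Q`, so the
signed readout sum isolates a single fidelity. -/
lemma NoiseModel.sum_trace_mcm (N : NoiseModel m n Γ) (G : Op (Qubits m n)) (Q : Pauli (Fin m))
    (u v : Fin n → ZMod 2) (σ : Op (Qubits m n)) :
    ∑ k, (sgn ((u + v) ⬝ᵥ k) : ℂ) * (pauliMat (ancillaPauli Q v) * N.mcm G k σ).trace =
      mcmFidelity N.rate u v Q * (Gᴴ * pauliMat (ancillaPauli Q u) * G * σ).trace := by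
  have hG : (Gᴴ * pauliMat (ancillaPauli Q u) * G * σ).trace =
      (pauliMat (ancillaPauli Q u) * (G * σ * Gᴴ)).trace := by
    rw [mul_assoc, mul_assoc, Matrix.trace_mul_comm, mul_assoc]
  rw [hG]
  set M := G * σ * Gᴴ with hM
  have h1 : ∀ k, (sgn ((u + v) ⬝ᵥ k) : ℂ) * (pauliMat (ancillaPauli Q v) * N.mcm G k σ).trace =
      ∑ a, ∑ b, ∑ P, (N.rate a b P : ℂ) * (((sgn ((u + v) ⬝ᵥ k) : ℂ) •
        ((kraus P (k + b) (k + a))ᴴ * pauliMat (ancillaPauli Q v) * kraus P (k + b) (k + a)))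
          * M).trace := by
    intro k
    simp only [NoiseModel.mcm, ← hM, Finset.mul_sum, Matrix.trace_sum, mul_smul_comm,
      Matrix.trace_smul, smul_mul_assoc, smul_eq_mul]
    refine Finset.sum_congr rfl fun a _ => Finset.sum_congr rfl fun b _ =>
      Finset.sum_congr rfl fun P _ => ?_
    rw [← mul_assoc (pauliMat _), Matrix.trace_mul_comm (_ * _) (kraus P _ _)ᴴ]
    simp only [mul_assoc]
    ring
  simp only [h1]
  rw [Finset.sum_comm]
  simp only [mcmFidelity, Complex.ofReal_sum, Finset.sum_mul]
  refine Finset.sum_congr rfl fun a _ => ?_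
  rw [Finset.sum_comm]
  refine Finset.sum_congr rfl fun b _ => ?_
  rw [Finset.sum_comm]
  refine Finset.sum_congr rfl fun P _ => ?_
  rw [← Finset.mul_sum, ← Matrix.trace_sum, ← Finset.sum_mul, sum_kraus_conj_ancillaPauli,
    smul_mul_assoc, Matrix.trace_smul, smul_eq_mul]
  push_cast
  ring

/-! ### The syndrome extraction circuit -/

/-- The projections onto the eigenspaces of `X`. -/
noncomputable def projX (b : ZMod 2) : Matrix (ZMod 2) (ZMod 2) ℂ :=
  fun r c => (-1) ^ (b.val * (r.val + c.val)) / 2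

lemma hadamard1_conj_proj1 (b : ZMod 2) : hadamard1 * proj1 b * hadamard1 = projX b := by
  have hs : ((Real.sqrt 2 : ℂ)) * (Real.sqrt 2 : ℂ) = 2 := by
    rw [← Complex.ofReal_mul, Real.mul_self_sqrt (by norm_num)]
    norm_num
  ext r c
  simp only [Matrix.mul_apply, sum_zmod_two, hadamard1, proj1, projX]
  rcases zmod_two_cases b with rfl | rfl <;> rcases zmod_two_cases r with rfl | rfl <;>
    rcases zmod_two_cases c with rfl | rfl <;>
    simp [zmod_two_val_one, ← mul_inv, div_eq_mul_inv, hs]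

lemma projX_add : projX 0 + projX 1 = 1 := by
  ext r c
  rcases zmod_two_cases r with rfl | rfl <;> rcases zmod_two_cases c with rfl | rfl <;>
    simp [projX, zmod_two_val_one] <;> norm_num

lemma projX_conjTranspose (b : ZMod 2) : (projX b)ᴴ = projX b := by
  ext r c
  simp [projX, Matrix.conjTranspose_apply, add_comm]

lemma projX_mul (b c : ZMod 2) : projX b * projX c = if b = c then projX b else 0 := by
  ext r t
  simp only [Matrix.mul_apply, sum_zmod_two]
  rcases zmod_two_cases b with rfl | rfl <;> rcases zmod_two_cases c with rfl | rfl <;>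
    rcases zmod_two_cases r with rfl | rfl <;> rcases zmod_two_cases t with rfl | rfl <;>
    simp [projX, zmod_two_val_one] <;> norm_num

lemma pauli1_mul_projX (z b : ZMod 2) :
    pauli1 (0, z) * projX b = projX (b + z) * pauli1 (0, z) := by
  ext r t
  simp only [Matrix.mul_apply, sum_zmod_two]
  rcases zmod_two_cases b with rfl | rfl <;> rcases zmod_two_cases z with rfl | rfl <;>
    rcases zmod_two_cases r with rfl | rfl <;> rcases zmod_two_cases t with rfl | rfl <;>
    simp [projX, pauli1, zmod_two_val_one, zmod_two_one_add_one] <;> norm_num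

section Update

variable {ι : Type*} [Fintype ι] [DecidableEq ι]

lemma tensor_update_apply (B : ι → Matrix (ZMod 2) (ZMod 2) ℂ) (i : ι)
    (A : Matrix (ZMod 2) (ZMod 2) ℂ) (r c : ι → ZMod 2) :
    tensor (Function.update B i A) r c =
      A (r i) (c i) * ∏ j ∈ {i}ᶜ, B j (r j) (c j) := by
  rw [tensor, Fintype.prod_eq_mul_prod_compl i, Function.update_self]
  congr 1
  refine Finset.prod_congr rfl fun j hj => ?_
  rw [Function.update_of_ne (by simpa using hj)]

/-- The operator `A` on the qubit `i`. -/
def onQubit (i : ι) (A : Matrix (ZMod 2) (ZMod 2) ℂ) : Op ι :=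
  tensor (Function.update (fun _ => 1) i A)

lemma onQubit_add (i : ι) (A B : Matrix (ZMod 2) (ZMod 2) ℂ) :
    onQubit i (A + B) = onQubit i A + onQubit i B := by
  ext r c
  simp [onQubit, tensor_update_apply, add_mul]

lemma onQubit_one (i : ι) : onQubit i 1 = 1 := by
  rw [onQubit, Function.update_eq_self i (fun _ => (1 : Matrix (ZMod 2) (ZMod 2) ℂ)), tensor_one]

lemma onQubit_zero (i : ι) : onQubit i 0 = 0 := by
  ext r c
  simp [onQubit, tensor_update_apply]

lemma onQubit_mul (i : ι) (A B : Matrix (ZMod 2) (ZMod 2) ℂ) :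
    onQubit i A * onQubit i B = onQubit i (A * B) := by
  rw [onQubit, onQubit, onQubit, tensor_mul]
  congr 1
  funext j
  by_cases h : j = i
  · subst h; simp
  · simp [h]

lemma onQubit_conjTranspose (i : ι) (A : Matrix (ZMod 2) (ZMod 2) ℂ) :
    (onQubit i A)ᴴ = onQubit i Aᴴ := by
  rw [onQubit, onQubit, tensor_conjTranspose]
  congr 1
  funext j
  by_cases h : j = i
  · subst h; simp
  · simp [h]

lemma pauliMat_mul_onQubit {P : Pauli ι} {i : ι} {A B : Matrix (ZMod 2) (ZMod 2) ℂ}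
    (h : pauli1 (P i) * A = B * pauli1 (P i)) :
    pauliMat P * onQubit i A = onQubit i B * pauliMat P := by
  rw [onQubit, onQubit, pauliMat, tensor_mul, tensor_mul]
  congr 1
  funext j
  by_cases hj : j = i
  · subst hj; simpa using h
  · simp [hj]

lemma mul_onQubit_conj (i : ι) (A B : Matrix (ZMod 2) (ZMod 2) ℂ) (M : Op ι)
    (h : Commute M (onQubit i A)) :
    onQubit i A * (onQubit i B * M) * onQubit i A = onQubit i (A * B * A) * M := by
  rw [mul_assoc, mul_assoc, h.eq, ← mul_assoc, ← mul_assoc, onQubit_mul, onQubit_mul]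

end Update

/-- The syndrome extraction gate for one stabilizer. -/
noncomputable def syndromeStep (S : Pauli (Fin m)) (i : Fin n) : Op (Qubits m n) :=
  hadamardAt i * controlled S i * hadamardAt i

/-- The Pauli operator `S ⊗ I`. -/
abbrev systemPauli (n : ℕ) (S : Pauli (Fin m)) : Pauli (Qubits m n) := ancillaPauli S 0

lemma commute_systemPauli_onQubit (S : Pauli (Fin m)) (i : Fin n)
    (A : Matrix (ZMod 2) (ZMod 2) ℂ) :
    Commute (pauliMat (systemPauli n S)) (onQubit (Sum.inr i) A) :=
  pauliMat_mul_onQubit (by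
    have : systemPauli n S (Sum.inr i) = 0 := rfl
    rw [this, pauli1_zero, one_mul, mul_one])

/-- The Hadamards act only on the ancilla and commute with `S`; they turn the control projections
into projections onto the eigenspaces of `X`. -/
lemma syndromeStep_eq (S : Pauli (Fin m)) (i : Fin n) :
    syndromeStep S i = onQubit (Sum.inr i) (projX 0) +
      onQubit (Sum.inr i) (projX 1) * pauliMat (systemPauli n S) := by
  have h : controlled S i = onQubit (Sum.inr i) (proj1 0) +
      onQubit (Sum.inr i) (proj1 1) * pauliMat (systemPauli n S) := by
    rw [controlled]
    congr 1
    rw [onQubit, pauliMat, tensor_mul]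
    congr 1
    funext j
    by_cases hj : j = Sum.inr i
    · subst hj
      have : systemPauli n S (Sum.inr i) = 0 := rfl
      simp [this, pauli1_zero]
    · rcases j with j | j
      · simp [ancillaPauli]
      · have : systemPauli n S (Sum.inr j) = 0 := rfl
        simp [hj, this, pauli1_zero]
  have hH : (hadamardAt i : Op (Qubits m n)) = onQubit (Sum.inr i) hadamard1 := rfl
  rw [syndromeStep, h, hH, mul_add, add_mul, onQubit_mul, onQubit_mul,
    mul_onQubit_conj _ _ _ _ (commute_systemPauli_onQubit S i _), hadamard1_conj_proj1,
    hadamard1_conj_proj1]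

lemma pauliInner_ancillaPauli (P Q : Pauli (Fin m)) (u v : Fin n → ZMod 2) :
    pauliInner (ancillaPauli P u) (ancillaPauli Q v) = pauliInner P Q := by
  simp [pauliInner, ancillaPauli]

lemma ancillaPauli_add (P Q : Pauli (Fin m)) (u v : Fin n → ZMod 2) :
    ancillaPauli P u + ancillaPauli Q v = ancillaPauli (P + Q) (u + v) := by
  funext j
  rcases j with j | j <;> simp [ancillaPauli]

/-- Write the step as `g = E₀ + E₁T`, which is self-adjoint. `Z` on the ancilla exchanges `E₀` and
`E₁`, so moving `Q ⊗ Z^u` past `g` leaves `g * g = 1` when `u i = 0` and `(E₀ + E₁T)(E₁ + E₀T) = T`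
when `u i = 1`. -/
lemma syndromeStep_conj (S Q : Pauli (Fin m)) (i : Fin n) (u : Fin n → ZMod 2)
    (h : pauliInner S Q = 0) : ∃ c : ℝ, c ≠ 0 ∧
      (syndromeStep S i)ᴴ * pauliMat (ancillaPauli Q u) * syndromeStep S i =
        (c : ℂ) • pauliMat (ancillaPauli (Q + u i • S) u) := by
  set T := pauliMat (systemPauli n S) with hT
  set A := pauliMat (ancillaPauli Q u) with hA
  set E : ZMod 2 → Op (Qubits m n) := fun b => onQubit (Sum.inr i) (projX b) with hE
  have hg : syndromeStep S i = E 0 + E 1 * T := syndromeStep_eq S i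
  have hTE : ∀ b, T * E b = E b * T := fun b => commute_systemPauli_onQubit S i _
  have hTT : T * T = 1 := pauliMat_mul_self _
  have hEE : ∀ b c, E b * E c = if b = c then E b else 0 := fun b c => by
    simp only [hE, onQubit_mul, projX_mul]
    split_ifs
    · rfl
    · exact onQubit_zero _
  have h01 : E 0 + E 1 = 1 := by
    simp only [hE]
    rw [← onQubit_add, projX_add, onQubit_one]
  have hAE : ∀ b, A * E b = E (b + u i) * A := fun b =>
    pauliMat_mul_onQubit (pauli1_mul_projX (u i) b)
  have hAT : A * T = T * A := by
    rw [hA, hT, pauliMat_comm, pauliInner_ancillaPauli, pauliInner_comm, h, sgn_zero]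
    simp
  have hgh : (syndromeStep S i)ᴴ = E 0 + E 1 * T := by
    rw [hg, Matrix.conjTranspose_add, Matrix.conjTranspose_mul, hT, pauliMat_conjTranspose, ← hT]
    simp only [hE, onQubit_conjTranspose, projX_conjTranspose]
    exact congrArg _ (hTE 1)
  have e00 : E 0 * E 0 = E 0 := by rw [hEE, if_pos rfl]
  have e11 : E 1 * E 1 = E 1 := by rw [hEE, if_pos rfl]
  have e01 : E 0 * E 1 = 0 := by rw [hEE, if_neg (by decide)]
  have e10 : E 1 * E 0 = 0 := by rw [hEE, if_neg (by decide)]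
  have key : (syndromeStep S i)ᴴ * A * syndromeStep S i =
      (E 0 + E 1 * T) * (E (0 + u i) + E (1 + u i) * T) * A := by
    rw [hgh, hg, mul_assoc, mul_assoc]
    congr 1
    rw [mul_add, add_mul, ← mul_assoc, hAE, hAE, mul_assoc, hAT, mul_assoc]
  have expand : ∀ X Y : Op (Qubits m n), Y * T = T * Y → (E 0 + E 1 * T) * (X + Y * T) =
      E 0 * X + E 0 * Y * T + E 1 * (T * X) + E 1 * Y := fun X Y hY => by
    rw [add_mul, mul_add, mul_add, mul_assoc (E 1) T (Y * T), ← mul_assoc T Y T, ← hY,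
      mul_assoc Y T T, hTT, mul_one, mul_assoc, mul_assoc, add_assoc, add_assoc, add_assoc]
  rcases zmod_two_cases (u i) with hu | hu
  · refine ⟨1, one_ne_zero, ?_⟩
    rw [key, hu, add_zero, add_zero, expand _ _ (hTE 1).symm, hTE, ← mul_assoc, e00, e01, e10, e11]
    simp [h01, hA]
  · obtain ⟨c, hc, hmul⟩ := pauliMat_mul_of_commute
      (P := systemPauli n S) (Q := ancillaPauli Q u) (by rw [pauliInner_ancillaPauli, h])
    refine ⟨c, hc, ?_⟩
    rw [key, hu, zero_add, zmod_two_one_add_one, expand _ _ (hTE 0).symm, hTE, ← mul_assoc, e00,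
      e01, e10, e11, one_smul, add_comm Q, ← zero_add u, ← ancillaPauli_add, zero_add, ← hmul,
      add_zero, ← add_mul, h01, one_mul]

lemma pauliInner_smul_right (P Q : Pauli (Fin m)) (z : ZMod 2) (h : pauliInner P Q = 0) :
    pauliInner P (z • Q) = 0 := by
  rcases zmod_two_cases z with rfl | rfl
  · simp [pauliInner]
  · rw [one_smul, h]

/-- `Q` is quantified inside the induction because each step changes it; mutual commutation of the
`Sᵢ` keeps the new operator admissible. -/
lemma syndromeStep_list_conj (S : Fin n → Pauli (Fin m))
    (hS : ∀ i j, pauliInner (S i) (S j) = 0) (u : Fin n → ZMod 2) (l : List (Fin n)) :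
    ∀ Q : Pauli (Fin m), (∀ i, pauliInner (S i) Q = 0) → ∃ c : ℝ, c ≠ 0 ∧
      ((l.map fun i => syndromeStep (S i) i).prod)ᴴ * pauliMat (ancillaPauli Q u) *
        (l.map fun i => syndromeStep (S i) i).prod =
      (c : ℂ) • pauliMat (ancillaPauli (Q + (l.map fun i => u i • S i).sum) u) := by
  induction l with
  | nil => exact fun Q _ => ⟨1, one_ne_zero, by simp⟩
  | cons i l ih =>
    intro Q hQ
    obtain ⟨c, hc, h1⟩ := syndromeStep_conj (S i) Q i u (hQ i)
    obtain ⟨d, hd, h2⟩ := ih (Q + u i • S i) fun j => by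
      rw [pauliInner_add_right, hQ, pauliInner_smul_right _ _ _ (hS j i), add_zero]
    refine ⟨c * d, mul_ne_zero hc hd, ?_⟩
    rw [List.map_cons, List.prod_cons, List.map_cons, List.sum_cons, Matrix.conjTranspose_mul,
      ← add_assoc, Complex.ofReal_mul, ← smul_smul, ← h2, ← smul_mul_assoc, ← mul_smul_comm, ← h1]
    simp only [mul_assoc]

lemma syndromeGate_conj (S : Fin n → Pauli (Fin m))
    (hS : ∀ i j, pauliInner (S i) (S j) = 0) (Q : Pauli (Fin m))
    (hQ : ∀ i, pauliInner (S i) Q = 0) (u : Fin n → ZMod 2) : ∃ c : ℝ, c ≠ 0 ∧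
      (syndromeGate S)ᴴ * pauliMat (ancillaPauli Q u) * syndromeGate S =
        (c : ℂ) • pauliMat (ancillaPauli (Q + stabPow S u) u) := by
  obtain ⟨c, hc, h⟩ := syndromeStep_list_conj S hS u (List.finRange n).reverse Q hQ
  refine ⟨c, hc, ?_⟩
  have h1 : syndromeGate S =
      ((List.finRange n).reverse.map fun i => syndromeStep (S i) i).prod := by
    rw [List.map_reverse, ← List.ofFn_eq_map]
    rfl
  have h2 : stabPow S u = ((List.finRange n).reverse.map fun i => u i • S i).sum := by
    rw [List.map_reverse, List.sum_reverse, ← List.ofFn_eq_map, List.sum_ofFn]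
    rfl
  rw [h1, h2, h]

/-- The constant is chosen before `N`, so two models share it and it cancels when they are compared.
Its being real allows passage to real parts. -/
lemma exists_sum_re_trace_mcm (S : Fin n → Pauli (Fin m))
    (hS : ∀ i j, pauliInner (S i) (S j) = 0) (Q : Pauli (Fin m))
    (hQ : ∀ i, pauliInner (S i) Q = 0) (u : Fin n → ZMod 2) : ∃ c : ℝ, c ≠ 0 ∧
      ∀ (N : NoiseModel m n Γ) (v : Fin n → ZMod 2) (σ : Op (Qubits m n)),
        ∑ k, sgn ((u + v) ⬝ᵥ k) *
            (pauliMat (ancillaPauli Q v) * N.mcm (syndromeGate S) k σ).trace.re =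
          mcmFidelity N.rate u v Q *
            (c * (pauliMat (ancillaPauli (Q + stabPow S u) u) * σ).trace.re) := by
  obtain ⟨c, hc, h⟩ := syndromeGate_conj S hS Q hQ u
  refine ⟨c, hc, fun N v σ => ?_⟩
  have h1 := congrArg Complex.re (N.sum_trace_mcm (syndromeGate S) Q u v σ)
  rw [h, smul_mul_assoc, Matrix.trace_smul, smul_eq_mul, Complex.re_ofReal_mul,
    Complex.re_ofReal_mul, Complex.re_sum] at h1
  simpa only [Complex.re_ofReal_mul] using h1

/-! ### Learnable products of fidelities -/

/-- The difference of the probabilities of the outcomes `±1` of the observable `O`, measured after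
the circuit `c`, jointly with the readouts `ks`. -/
noncomputable def NoiseModel.signedProb (N : NoiseModel m n Γ) (G : Op (Qubits m n))
    (gates : Γ → Op (Qubits m n)) (c : List (Step m n Γ)) (O : Op (Qubits m n))
    (ks : List (Fin n → ZMod 2)) : ℝ :=
  N.prob G gates c (observablePOVM O) ks 0 - N.prob G gates c (observablePOVM O) ks 1

lemma NoiseModel.signedProb_eq (N : NoiseModel m n Γ) (G : Op (Qubits m n))
    (gates : Γ → Op (Qubits m n)) (c : List (Step m n Γ)) (W : Pauli (Qubits m n))
    (ks : List (Fin n → ZMod 2)) :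
    N.signedProb G gates c (pauliMat W) ks = pauliFidelity N.termNoise.rate W *
      (pauliMat W * N.run G gates c ks N.state).trace.re := by
  rw [signedProb, prob, prob, ← Complex.sub_re, ← Matrix.trace_sub, ← sub_mul]
  have : observablePOVM (pauliMat W) 0 - observablePOVM (pauliMat W) 1 = pauliMat W := by
    simp only [observablePOVM, Matrix.cons_val_zero, Matrix.cons_val_one]
    rw [← smul_sub, show 1 + pauliMat W - (1 - pauliMat W) = (2 : ℂ) • pauliMat W by
      rw [two_smul]; abel, smul_smul]
    norm_num
  rw [this, trace_pauliMat_mul_apply, Complex.re_ofReal_mul]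

lemma Indistinguishable.signedProb_eq {G : Op (Qubits m n)} {gates : Γ → Op (Qubits m n)}
    {N₁ N₂ : NoiseModel m n Γ} (h : Indistinguishable G gates N₁ N₂) (c : List (Step m n Γ))
    (W : Pauli (Qubits m n)) (ks : List (Fin n → ZMod 2)) :
    N₁.signedProb G gates c (pauliMat W) ks = N₂.signedProb G gates c (pauliMat W) ks := by
  have hF := isPOVM_observablePOVM (pauliMat_conjTranspose W) (pauliMat_mul_self W)
  rw [NoiseModel.signedProb, NoiseModel.signedProb, h c _ _ hF, h c _ _ hF]

lemma trace_re_ne_zero {ι : Type*} [Fintype ι] [DecidableEq ι] {A B : Matrix ι ι ℂ}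
    (hA : Aᴴ = A) (hB : Bᴴ = B) (h : (A * B).trace ≠ 0) : (A * B).trace.re ≠ 0 := by
  intro h0
  have h1 : star (A * B).trace = (A * B).trace := by
    rw [← Matrix.trace_conjTranspose, Matrix.conjTranspose_mul, hA, hB, Matrix.trace_mul_comm]
  exact h (Complex.ext h0 (Complex.conj_eq_iff_im.1 h1))

/-- The product of the fidelities along the cycle of length four that starts at `Q ⊗ Z^u`. -/
noncomputable def cycleFidelity (p : (Fin n → ZMod 2) → (Fin n → ZMod 2) → Pauli (Fin m) → ℝ)
    (S : Fin n → Pauli (Fin m)) (u v : Fin n → ZMod 2) (Q : Pauli (Fin m)) : ℝ :=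
  mcmFidelity p v u Q * mcmFidelity p u v (Q + stabPow S v) *
    mcmFidelity p v u (Q + stabPow S v + stabPow S u) *
    mcmFidelity p u v (Q + stabPow S v + stabPow S u + stabPow S v)

lemma pauliInner_stabPow_right {S : Fin n → Pauli (Fin m)} (Q : Pauli (Fin m))
    (hQ : ∀ i, pauliInner Q (S i) = 0) (k : Fin n → ZMod 2) :
    pauliInner Q (stabPow S k) = 0 := by
  let f : Pauli (Fin m) →+ ZMod 2 := AddMonoidHom.mk' (pauliInner Q) (pauliInner_add_right Q)
  have : f (stabPow S k) = 0 := by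
    rw [stabPow, map_sum]
    exact Finset.sum_eq_zero fun i _ => pauliInner_smul_right _ _ _ (hQ i)
  exact this

lemma stabPow_cycle (S : Fin n → Pauli (Fin m)) (u v : Fin n → ZMod 2) (Q : Pauli (Fin m)) :
    Q + stabPow S v + stabPow S u + stabPow S v + stabPow S u = Q := by
  have h : ∀ P : Pauli (Fin m), P + P = 0 := fun P => by ext <;> simp [CharTwo.add_self_eq_zero]
  rw [show Q + stabPow S v + stabPow S u + stabPow S v + stabPow S u =
    Q + (stabPow S v + stabPow S v) + (stabPow S u + stabPow S u) by abel, h, h, add_zero,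
    add_zero]

/-- The observable is pulled back through the MCMs from last to first, its ancilla label alternating
`u, v, u, v, u`; by `stabPow_cycle` it ends where it began, leaving the experiment without MCMs as a
factor. -/
lemma exists_sum_signedProb {S : Fin n → Pauli (Fin m)} (gates : Γ → Op (Qubits m n))
    (hS : ∀ i j, pauliInner (S i) (S j) = 0) {Q : Pauli (Fin m)}
    (hQ : ∀ i, pauliInner (S i) Q = 0) (u v : Fin n → ZMod 2) : ∃ c : ℝ, c ≠ 0 ∧
      ∀ (N : NoiseModel m n Γ) (U : Qubits m n → Matrix.unitaryGroup (ZMod 2) ℂ),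
        ∑ k₁, sgn ((u + v) ⬝ᵥ k₁) * ∑ k₂, sgn ((v + u) ⬝ᵥ k₂) * ∑ k₃, sgn ((u + v) ⬝ᵥ k₃) *
          ∑ k₄, sgn ((v + u) ⬝ᵥ k₄) * N.signedProb (syndromeGate S) gates
            [.layer U, .measure, .measure, .measure, .measure] (pauliMat (ancillaPauli Q u))
            [k₁, k₂, k₃, k₄] =
        c * cycleFidelity N.rate S u v Q * N.signedProb (syndromeGate S) gates [.layer U]
          (pauliMat (ancillaPauli Q u)) [] := by
  have hstab : ∀ i k, pauliInner (S i) (stabPow S k) = 0 := fun i k =>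
    pauliInner_stabPow_right _ (hS i) k
  have hadd : ∀ {Q' : Pauli (Fin m)} k, (∀ i, pauliInner (S i) Q' = 0) →
      ∀ i, pauliInner (S i) (Q' + stabPow S k) = 0 := fun k h i => by
    rw [pauliInner_add_right, h, hstab, add_zero]
  obtain ⟨c₄, hc₄, h₄⟩ := exists_sum_re_trace_mcm (Γ := Γ) S hS Q hQ v
  obtain ⟨c₃, hc₃, h₃⟩ := exists_sum_re_trace_mcm (Γ := Γ) S hS _ (hadd v hQ) u
  obtain ⟨c₂, hc₂, h₂⟩ := exists_sum_re_trace_mcm (Γ := Γ) S hS _ (hadd u (hadd v hQ)) v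
  obtain ⟨c₁, hc₁, h₁⟩ := exists_sum_re_trace_mcm (Γ := Γ) S hS _ (hadd v (hadd u (hadd v hQ))) u
  refine ⟨c₁ * c₂ * c₃ * c₄, by positivity, fun N U => ?_⟩
  have pull : ∀ (a : ℝ) (f g : (Fin n → ZMod 2) → ℝ),
      ∑ k, f k * (a * g k) = a * ∑ k, f k * g k := fun a f g => by
    rw [Finset.mul_sum]
    exact Finset.sum_congr rfl fun k _ => mul_left_comm _ _ _
  simp only [N.signedProb_eq, NoiseModel.run, pull, h₄, h₃, h₂, h₁, stabPow_cycle, cycleFidelity]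
  ring

-- All the signed probabilities are observable, so the cycle product is their quotient, provided
-- that the reference experiment has nonzero signal.
open scoped ComplexOrder in
lemma Indistinguishable.cycleFidelity_eq {S : Fin n → Pauli (Fin m)}
    {gates : Γ → Op (Qubits m n)} {N₁ N₂ : NoiseModel m n Γ}
    (h : Indistinguishable (syndromeGate S) gates N₁ N₂)
    (hS : ∀ i j, pauliInner (S i) (S j) = 0) {Q : Pauli (Fin m)}
    (hQ : ∀ i, pauliInner (S i) Q = 0) (u v : Fin n → ZMod 2) :
    cycleFidelity N₁.rate S u v Q = cycleFidelity N₂.rate S u v Q := by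
  obtain ⟨c, hc, hsum⟩ := exists_sum_signedProb gates hS hQ u v
  -- The layer rotates a Pauli component `R` present in the state of `N₁` into the measured
  -- observable. The resulting nonzero signal transfers to `N₂` by indistinguishability.
  obtain ⟨R, hR, hRne⟩ := N₁.state_overlap (pattern (ancillaPauli Q u))
  obtain ⟨U, hU⟩ := exists_layer_conj_pauliMat hR
  have h1 := hsum N₁ U
  simp only [h.signedProb_eq] at h1
  rw [hsum N₂ U] at h1
  have hne : N₂.signedProb (syndromeGate S) gates [.layer U]
      (pauliMat (ancillaPauli Q u)) [] ≠ 0 := by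
    rw [← h.signedProb_eq, N₁.signedProb_eq]
    refine mul_ne_zero (N₁.termNoise.fidelity_pos _).ne' ?_
    simp only [NoiseModel.run]
    have htr : (pauliMat (ancillaPauli Q u) * (tensor (fun i => (U i).1) * N₁.state *
        (tensor (fun i => (U i).1))ᴴ)).trace = (pauliMat R * N₁.state).trace := by
      rw [← hU, ← mul_assoc, Matrix.trace_mul_comm]
      simp only [mul_assoc]
    rw [htr]
    exact trace_re_ne_zero (pauliMat_conjTranspose R) N₁.state_posSemidef.isHermitian.eq hRne
  exact (mul_left_cancel₀ hc (mul_right_cancel₀ hne h1)).symm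

lemma NoiseModel.log_cycleFidelity (N : NoiseModel m n Γ) (S : Fin n → Pauli (Fin m))
    (u v : Fin n → ZMod 2) (Q : Pauli (Fin m)) :
    Real.log (cycleFidelity N.rate S u v Q) =
      Real.log (mcmFidelity N.rate v u Q) + Real.log (mcmFidelity N.rate u v (Q + stabPow S v)) +
        Real.log (mcmFidelity N.rate v u (Q + stabPow S v + stabPow S u)) +
        Real.log (mcmFidelity N.rate u v (Q + stabPow S v + stabPow S u + stabPow S v)) := by
  have h := fun x y Q => (N.fidelity_pos x y Q).ne'
  rw [cycleFidelity, Real.log_mul (mul_ne_zero (mul_ne_zero (h _ _ _) (h _ _ _)) (h _ _ _))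
    (h _ _ _), Real.log_mul (mul_ne_zero (h _ _ _) (h _ _ _)) (h _ _ _),
    Real.log_mul (h _ _ _) (h _ _ _)]

/-! ### The sum over a stabilizer coset -/

/-- The Fourier transform of the indicator function of the coset of `P`. -/
noncomputable def cosetWeight (S : Fin n → Pauli (Fin m)) (P Q : Pauli (Fin m)) : ℝ :=
  ∑ k, sgn (pauliInner (stabPow S k + P) Q)

lemma stabPow_add (S : Fin n → Pauli (Fin m)) (k l : Fin n → ZMod 2) :
    stabPow S (k + l) = stabPow S k + stabPow S l := by
  simp [stabPow, add_smul, Finset.sum_add_distrib]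

lemma stabPow_single (S : Fin n → Pauli (Fin m)) (i : Fin n) :
    stabPow S (Pi.single i 1) = S i := by
  rw [stabPow, Finset.sum_eq_single i] <;> simp +contextual

/-- Up to a sign the weight is the character sum of `k ↦ ⟨S^k, Q⟩`, which vanishes unless this
homomorphism is trivial. -/
lemma cosetWeight_ne_zero {S : Fin n → Pauli (Fin m)} {P Q : Pauli (Fin m)}
    (h : cosetWeight S P Q ≠ 0) (i : Fin n) : pauliInner (S i) Q = 0 := by
  classical
  let f : (Fin n → ZMod 2) →+ ZMod 2 := AddMonoidHom.mk' (fun k => pauliInner (stabPow S k) Q)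
    fun k l => by rw [stabPow_add, pauliInner_add_left]
  have h1 : cosetWeight S P Q = (∑ k, sgn (f k)) * sgn (pauliInner P Q) := by
    rw [cosetWeight, Finset.sum_mul]
    exact Finset.sum_congr rfl fun k _ => by rw [pauliInner_add_left, sgn_add]; rfl
  have h2 : f = 0 := by
    by_contra h0
    exact h (by rw [h1, sum_sgn_hom, if_neg h0, zero_mul])
  rw [← stabPow_single S i]
  exact DFunLike.congr_fun h2 _

/-- Every element of the coset of `P` commutes with `S^u`, so the shift changes no sign. -/
lemma cosetWeight_add {S : Fin n → Pauli (Fin m)} (hS : ∀ i j, pauliInner (S i) (S j) = 0)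
    {P : Pauli (Fin m)} (hP : ∀ i, pauliInner (S i) P = 0) (Q : Pauli (Fin m))
    (u : Fin n → ZMod 2) : cosetWeight S P (Q + stabPow S u) = cosetWeight S P Q := by
  refine Finset.sum_congr rfl fun k _ => ?_
  have h : pauliInner (stabPow S k + P) (stabPow S u) = 0 :=
    pauliInner_stabPow_right _ (fun i => by
      rw [pauliInner_add_left, pauliInner_comm, pauliInner_stabPow_right _ (hS i),
        pauliInner_comm, hP, add_zero]) u
  rw [pauliInner_add_right, h, add_zero]

/-- This separates a constant independent of the model from the weighted sum of logarithms. -/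
lemma NoiseModel.sum_firstOrderRate (N : NoiseModel m n Γ) (S : Fin n → Pauli (Fin m))
    (P : Pauli (Fin m)) :
    ∑ k, N.firstOrderRate 0 0 (stabPow S k + P) = 1 / 4 ^ (n + m) *
      (∑ _x : Fin n → ZMod 2, ∑ _y : Fin n → ZMod 2, ∑ Q, cosetWeight S P Q +
        ∑ x, ∑ y, ∑ Q, cosetWeight S P Q * Real.log (mcmFidelity N.rate x y Q)) := by
  simp only [firstOrderRate, ← Finset.mul_sum, ← Finset.sum_add_distrib]
  congr 1
  rw [Finset.sum_comm]
  refine Finset.sum_congr rfl fun x _ => ?_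
  rw [Finset.sum_comm]
  refine Finset.sum_congr rfl fun y _ => ?_
  rw [Finset.sum_comm]
  refine Finset.sum_congr rfl fun Q _ => ?_
  simp only [zero_dotProduct, zero_add, ← Finset.sum_mul, cosetWeight]
  ring

/-- Shift invariance of the weight removes the stabilizer shifts inside a cycle, leaving two terms
with labels `(u, v)` and two with `(v, u)`; these agree after summation over both labels. -/
lemma NoiseModel.four_mul_sum_log (N : NoiseModel m n Γ) {S : Fin n → Pauli (Fin m)}
    (hS : ∀ i j, pauliInner (S i) (S j) = 0) {P : Pauli (Fin m)}
    (hP : ∀ i, pauliInner (S i) P = 0) :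
    ∑ u, ∑ v, ∑ Q, cosetWeight S P Q * Real.log (cycleFidelity N.rate S u v Q) =
      4 * ∑ x, ∑ y, ∑ Q, cosetWeight S P Q * Real.log (mcmFidelity N.rate x y Q) := by
  have hshift : ∀ (k : Fin n → ZMod 2) (g : Pauli (Fin m) → ℝ),
      ∑ Q, cosetWeight S P Q * g (Q + stabPow S k) = ∑ Q, cosetWeight S P Q * g Q := fun k g =>
    Fintype.sum_equiv (Equiv.addRight (stabPow S k)) _ _ fun Q => by
      rw [Equiv.coe_addRight, cosetWeight_add hS hP]
  set L : (Fin n → ZMod 2) → (Fin n → ZMod 2) → ℝ := fun x y =>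
    ∑ Q, cosetWeight S P Q * Real.log (mcmFidelity N.rate x y Q) with hL
  have h : ∀ u v, ∑ Q, cosetWeight S P Q * Real.log (cycleFidelity N.rate S u v Q) =
      2 * L v u + 2 * L u v := by
    intro u v
    have e1 := hshift v fun Q => Real.log (mcmFidelity N.rate u v Q)
    have e2 := hshift (v + u) fun Q => Real.log (mcmFidelity N.rate v u Q)
    have e3 := hshift (v + u + v) fun Q => Real.log (mcmFidelity N.rate u v Q)
    simp only [stabPow_add, ← add_assoc] at e1 e2 e3
    simp only [N.log_cycleFidelity, mul_add, Finset.sum_add_distrib, e1, e2, e3, hL]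
    ring
  simp only [h, Finset.sum_add_distrib, ← Finset.mul_sum]
  rw [Finset.sum_comm (f := fun u v => L v u)]
  ring

theorem learnable_sum_firstOrderRate (gates : Γ → Op (Qubits m n)) {S : Fin n → Pauli (Fin m)}
    (hS : ∀ i j, pauliInner (S i) (S j) = 0) {P : Pauli (Fin m)}
    (hP : ∀ i, pauliInner (S i) P = 0) :
    Learnable (syndromeGate S) gates
      (fun N => ∑ k : Fin n → ZMod 2, N.firstOrderRate 0 0 (stabPow S k + P)) := by
  intro N₁ N₂ h
  have key : ∑ u, ∑ v, ∑ Q, cosetWeight S P Q * Real.log (cycleFidelity N₁.rate S u v Q) =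
      ∑ u, ∑ v, ∑ Q, cosetWeight S P Q * Real.log (cycleFidelity N₂.rate S u v Q) := by
    refine Finset.sum_congr rfl fun u _ => Finset.sum_congr rfl fun v _ =>
      Finset.sum_congr rfl fun Q _ => ?_
    -- Cycles are compared only for `Q` in the support of the weight, where commutation with the
    -- stabilizers is automatic.
    by_cases hW : cosetWeight S P Q = 0
    · rw [hW, zero_mul, zero_mul]
    · rw [h.cycleFidelity_eq hS (cosetWeight_ne_zero hW)]
  rw [N₁.four_mul_sum_log hS hP, N₂.four_mul_sum_log hS hP] at key
  simp only [NoiseModel.sum_firstOrderRate]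
  rw [mul_left_cancel₀ four_ne_zero key]

theorem NoiseModel.abs_sum_rate_sub_sum_firstOrderRate_le (N : NoiseModel m n Γ)
    (hN : 1 - N.rate 0 0 0 ≤ 1 / 4) (f : (Fin n → ZMod 2) → Pauli (Fin m)) :
    |∑ k, N.rate 0 0 (f k) - ∑ k, N.firstOrderRate 0 0 (f k)| ≤
      4 * 2 ^ n * (1 - N.rate 0 0 0) ^ 2 := by
  rw [← Finset.sum_sub_distrib]
  refine (Finset.abs_sum_le_sum_abs _ _).trans ?_
  refine (Finset.sum_le_sum fun k _ => N.abs_rate_sub_firstOrderRate_le hN 0 0 (f k)).trans ?_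
  simp only [Finset.sum_const, Finset.card_univ, Fintype.card_pi, ZMod.card, Finset.prod_const,
    Fintype.card_fin, nsmul_eq_mul]
  push_cast
  linarith

end MCM

theorem proposition2 (m n : ℕ) {Γ : Type*} (gates : Γ → MCM.Op (MCM.Qubits m n))
    (hgates : ∀ g, MCM.IsClifford (gates g))
    (S : Fin n → MCM.Pauli (Fin m)) (hS : ∀ i j, MCM.pauliInner (S i) (S j) = 0)
    (P : MCM.Pauli (Fin m)) (hP : ∀ i, MCM.pauliInner (S i) P = 0) :
    MCM.Learnable (MCM.syndromeGate S) gates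
        (fun N => ∑ k : Fin n → ZMod 2, N.firstOrderRate 0 0 (MCM.stabPow S k + P)) ∧
      ∀ N : MCM.NoiseModel m n Γ, 1 - N.rate 0 0 0 ≤ 1 / 4 →
        |∑ k : Fin n → ZMod 2, N.rate 0 0 (MCM.stabPow S k + P) -
            ∑ k : Fin n → ZMod 2, N.firstOrderRate 0 0 (MCM.stabPow S k + P)| ≤
          4 * 2 ^ n * (1 - N.rate 0 0 0) ^ 2 :=
  ⟨MCM.learnable_sum_firstOrderRate gates hS hP,
    fun N hN => N.abs_sum_rate_sub_sum_firstOrderRate_le hN _⟩
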